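/- Let $q$ be a power of $2$ and let $\mathcal I(q)$ be the set of monic irreducible polynomials over $\mathbb F_q$. For a partition $\lambda$ and $i\ge 1$ let $m_i(\lambda)$ be the number of parts of $\lambda$ equal to $i$. For a monic polynomial $\phi$ let $M(\phi)$ be its companion matrix, and for $\phi\in\mathcal I(q)$ with roots $\alpha_1,\dots,\alpha_d$ in an algebraic closure of $\mathbb F_q$ let $\phi^{(2)}(X)=\prod_{j}(X-\alpha_j^2)$. A function $\Lambda$ from $\mathcal I(q)$ to the set of partitions, with $\Lambda(\phi)=\emptyset$ for all but finitely many $\phi$, is called class data of $A\in\mathrm{Mat}_n(\mathbb F_q)$ if $A$ is similar over $\mathbb F_q$ to $\bigoplus_{\phi\in\mathcal I(q)}\bigoplus_{r} M(\phi^{r})$, where $r$ runs over the parts of $\Lambda(\phi)$ with multiplicity. Suppose that $A\in \mathrm{Mat}_n(\mathbb F_q)$ has class data $\Lambda$. Then $\phi\mapsto\phi^{(2)}$ is a bijection of $\mathcal I(q)$ onto itself, and $A^2$ has unique class data $\mathcal M$, which satisfies $$m_i(\mathcal M(\phi^{(2)})) = 2\,m_{2i}(\Lambda(\phi)) + m_{2i-1}(\Lambda(\phi))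 + m_{2i+1}(\Lambda(\phi))$$ for all $\phi\in\mathcal I(q)$ and all $i\ge 1$. -/

import Mathlib

open Polynomial

noncomputable section

namespace MatSq

/-- Integer partitions of arbitrary weight, with Mathlib's convention that a partition is the
multiset of its positive parts (the infinitely many zero parts of the sequence are not listed). -/
abbrev IntPartition : Type := Σ w : ℕ, Nat.Partition w

namespace IntPartition

/-- The multiset of (positive) parts. -/
def parts (l : IntPartition) : Multiset ℕ := l.2.parts

/-- `m_i(l)`, the number of parts of `l` equal to `i` (used for `i ≥ 1`). -/
def mult (l : IntPartition) (i : ℕ) : ℕ := l.parts.count i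

end IntPartition

/-- The set of monic irreducible polynomials over `F`. -/
abbrev MonicIrred (F : Type*) [Field F] : Type _ := {φ : F[X] // φ.Monic ∧ Irreducible φ}

/-- Class data: a function from monic irreducible polynomials to partitions with empty value
at all but finitely many polynomials. -/
structure ClassData (F : Type*) [Field F] where
  toFun : MonicIrred F → IntPartition
  finite_support : {φ | (toFun φ).parts ≠ 0}.Finite

instance (F : Type*) [Field F] : CoeFun (ClassData F) (fun _ => MonicIrred F → IntPartition) :=
  ⟨ClassData.toFun⟩

/-- The companion matrix of a (monic) polynomial: ones on the superdiagonal, and last row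
`-a_0, -a_1, …, -a_{d-1}`. For `φ = 1` it is the empty matrix. -/
def companion {F : Type*} [Field F] (φ : F[X]) :
    Matrix (Fin φ.natDegree) (Fin φ.natDegree) F :=
  Matrix.of fun i j =>
    if (i : ℕ) + 1 = φ.natDegree then -φ.coeff j
    else if (j : ℕ) = i + 1 then 1 else 0

/-- Index set of the direct sum `⨁_φ ⨁_{r part of Λ(φ)} M(φ^r)`; an element of
`Multiset.ToType` is a part `r` together with a label for its repetitions. -/
abbrev ClassData.Index {F : Type*} [Field F] (Λ : ClassData F) : Type _ :=
  Σ φ : MonicIrred F, Σ r : (Λ φ).parts.ToType, Fin (φ.1 ^ r.1).natDegree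

open Classical in
/-- The standard representative `⨁_φ ⨁_{r part of Λ(φ)} M(φ^r)`. -/
def ClassData.standardRep {F : Type*} [Field F] (Λ : ClassData F) :
    Matrix Λ.Index Λ.Index F :=
  Matrix.blockDiagonal' fun φ : MonicIrred F =>
    Matrix.blockDiagonal' fun r : (Λ φ).parts.ToType => companion (φ.1 ^ r.1)

/-- `A` has class data `Λ`: for some numbering of the rows and columns of the standard
representative of `Λ` by `Fin n` (the same one for rows and columns), `A` is similar to it. -/
def HasClassData {F : Type*} [Field F] {n : ℕ} (A : Matrix (Fin n) (Fin n) F)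
    (Λ : ClassData F) : Prop :=
  ∃ e : Fin n ≃ Λ.Index, ∃ U : Matrix (Fin n) (Fin n) F, IsUnit U ∧
    A = U⁻¹ * Λ.standardRep.submatrix e e * U

/-- `φ^{(r)} = ∏ (X - α ^ r)` over the roots `α` of `φ` in the algebraic closure, with
multiplicity, as a polynomial over the algebraic closure. -/
def rootPow {F : Type*} [Field F] (r : ℕ) (φ : F[X]) : (AlgebraicClosure F)[X] :=
  ((φ.aroots (AlgebraicClosure F)).map fun α => X - C (α ^ r)).prod

end MatSq

end

noncomputable section

namespace MatSq

/-! Class data are read as an isomorphism of `F[X]`-modules: the space with `X` acting as the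
transpose of `A` is the sum of the cyclic modules `F[X]/(φ^r)` (`hasClassData_iff`). Existence is
the structure theorem over a PID. In such a sum `dim ker φ(A)^k = deg φ * ∑ min(r, k)`, over the
parts `r` of `Λ(φ)`. The second difference in `k` of the right-hand side recovers every
multiplicity, whence uniqueness. In characteristic 2, `φ^{(2)}` is `φ` with squared coefficients. So
`φ ↦ φ^{(2)}` is induced by a ring automorphism of `F[X]`, and `φ^{(2)}(X^2) = φ(X)^2`. Therefore
`ker φ^{(2)}(A^2)^k = ker φ(A)^{2k}`, and the multiplicities of `A^2` are second differences, with
step 2, of the kernel dimensions of `A`. -/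

/-! ### Kernel dimensions in one cyclic module -/

theorem finrank_ker_lmul_of_isCoprime {F : Type*} [Field F] {f p : F[X]} (h : IsCoprime f p) :
    Module.finrank F (LinearMap.ker (Algebra.lmul F (AdjoinRoot f) (AdjoinRoot.mk f p))) = 0 := by
  obtain ⟨a, b, hab⟩ := h
  have hu : AdjoinRoot.mk f b * AdjoinRoot.mk f p = 1 := by
    rw [← map_mul, ← map_one (AdjoinRoot.mk f), ← hab, map_add, map_mul (AdjoinRoot.mk f) a,
      AdjoinRoot.mk_self, mul_zero, zero_add]
  have : LinearMap.ker (Algebra.lmul F (AdjoinRoot f) (AdjoinRoot.mk f p)) = ⊥ := by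
    rw [LinearMap.ker_eq_bot']
    intro m hm
    have hm' : AdjoinRoot.mk f p * m = 0 := hm
    rw [← one_mul m, ← hu, mul_assoc, hm', mul_zero]
  rw [this, finrank_bot]

theorem finrank_adjoinRoot {F : Type*} [Field F] (f : F[X]) :
    Module.finrank F (AdjoinRoot f) = f.natDegree :=
  finrank_quotient_span_eq_natDegree

theorem finrank_ker_lmul_of_mul {F : Type*} [Field F] {a g : F[X]} (ha : a ≠ 0) (hg : g ≠ 0) :
    Module.finrank F (LinearMap.ker
      (Algebra.lmul F (AdjoinRoot (a * g)) (AdjoinRoot.mk (a * g) a))) = a.natDegree := by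
  have := (AdjoinRoot.powerBasis (mul_ne_zero ha hg)).finite
  let π : AdjoinRoot (a * g) →ₐ[F] AdjoinRoot g :=
    Ideal.Quotient.factorₐ F (Ideal.span_singleton_le_span_singleton.2 (dvd_mul_left g a))
  have hπ (p : F[X]) : π (AdjoinRoot.mk (a * g) p) = AdjoinRoot.mk g p := rfl
  have hsurj : Function.Surjective π := fun y => by
    obtain ⟨p, rfl⟩ := AdjoinRoot.mk_surjective y
    exact ⟨_, hπ p⟩
  -- Modulo `a * g`, being killed by `a` means being divisible by `g`, so the dimension is `deg (a *
  -- g) - deg g`.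
  have hker : LinearMap.ker (Algebra.lmul F (AdjoinRoot (a * g)) (AdjoinRoot.mk (a * g) a)) =
      LinearMap.ker π.toLinearMap := by
    ext x
    obtain ⟨p, rfl⟩ := AdjoinRoot.mk_surjective x
    rw [LinearMap.mem_ker, LinearMap.mem_ker]
    change AdjoinRoot.mk (a * g) a * AdjoinRoot.mk (a * g) p = 0 ↔ AdjoinRoot.mk g p = 0
    rw [← map_mul, AdjoinRoot.mk_eq_zero, AdjoinRoot.mk_eq_zero, mul_dvd_mul_iff_left ha]
  have h := π.toLinearMap.finrank_range_add_finrank_ker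
  rw [LinearMap.range_eq_top.2 hsurj, finrank_top, finrank_adjoinRoot, finrank_adjoinRoot,
    natDegree_mul ha hg, ← hker] at h
  omega

theorem finrank_ker_lmul_pow {F : Type*} [Field F] {φ : F[X]} (hφ : φ ≠ 0) (r k : ℕ) :
    Module.finrank F (LinearMap.ker
      (Algebra.lmul F (AdjoinRoot (φ ^ r)) (AdjoinRoot.mk (φ ^ r) (φ ^ k)))) =
      min r k * φ.natDegree := by
  rcases le_total k r with h | h
  · have := finrank_ker_lmul_of_mul (pow_ne_zero k hφ) (pow_ne_zero (r - k) hφ)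
    rw [← pow_add, Nat.add_sub_cancel' h, natDegree_pow] at this
    rw [this, min_eq_right h]
  · have h0 : AdjoinRoot.mk (φ ^ r) (φ ^ k) = 0 := AdjoinRoot.mk_eq_zero.2 (pow_dvd_pow φ h)
    rw [h0, map_zero, LinearMap.ker_zero, finrank_top, finrank_adjoinRoot, natDegree_pow,
      min_eq_left h]

/-- Kernels of linear maps acting componentwise are products of kernels. -/
def kerPiEquiv {F ι : Type*} [Field F] {V : ι → Type*} [∀ i, AddCommGroup (V i)]
    [∀ i, Module F (V i)] (g : (∀ i, V i) →ₗ[F] ∀ i, V i) (h : ∀ i, V i →ₗ[F] V i)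
    (hg : ∀ v i, g v i = h i (v i)) :
    LinearMap.ker g ≃ₗ[F] ∀ i, LinearMap.ker (h i) where
  toFun v i := ⟨v.1 i, by rw [LinearMap.mem_ker, ← hg, LinearMap.mem_ker.1 v.2, Pi.zero_apply]⟩
  invFun w := ⟨fun i => (w i).1, LinearMap.mem_ker.2 <| funext fun i => by
    rw [hg, LinearMap.mem_ker.1 (w i).2, Pi.zero_apply]⟩
  map_add' _ _ := rfl
  map_smul' _ _ := rfl
  left_inv _ := rfl
  right_inv _ := rfl

/-! ### Multiplication by `X` on a sum of cyclic modules -/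

namespace ClassData

variable {F : Type*} [Field F] (Λ : ClassData F)

/-- Index set of the elementary divisors, with repetition. -/
abbrev Summand : Type _ := Σ φ : MonicIrred F, (Λ φ).parts.ToType

/-- The elementary divisor labelled by a summand. -/
abbrev divisor (x : Λ.Summand) : F[X] := x.1.1 ^ x.2.1

instance : Finite Λ.Summand := by
  have := Λ.finite_support.to_subtype
  refine Finite.of_injective (β := Σ φ : {φ | (Λ φ).parts ≠ 0}, (Λ φ.1).parts.ToType)
    (fun x => ⟨⟨x.1, fun h => ?_⟩, x.2⟩) ?_
  · exact Multiset.eq_zero_iff_forall_notMem.1 h _ (Multiset.coe_mem (x := x.2))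
  · rintro ⟨φ, x⟩ ⟨ψ, y⟩ h
    simp only [Sigma.mk.injEq, Subtype.mk.injEq] at h
    exact Sigma.ext h.1 h.2

instance : Fintype Λ.Summand := Fintype.ofFinite _

theorem divisor_monic (x : Λ.Summand) : (Λ.divisor x).Monic := x.1.2.1.pow _

/-- The sum of the cyclic modules `F[X] / (φ ^ r)`. -/
abbrev Space : Type _ := ∀ x : Λ.Summand, AdjoinRoot (Λ.divisor x)

instance (x : Λ.Summand) : Module.Finite F (AdjoinRoot (Λ.divisor x)) :=
  (Λ.divisor_monic x).finite_adjoinRoot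

/-- Multiplication by `X` on the sum of cyclic modules. -/
def mulX : Λ.Space →ₗ[F] Λ.Space :=
  Algebra.lmul F Λ.Space fun x => AdjoinRoot.root (Λ.divisor x)

theorem aeval_mulX (p : F[X]) :
    aeval Λ.mulX p = Algebra.lmul F Λ.Space fun x => AdjoinRoot.mk (Λ.divisor x) p := by
  rw [mulX, aeval_algHom_apply]
  congr 1
  ext x
  change Pi.evalAlgHom F _ x (aeval _ p) = _
  rw [← aeval_algHom_apply]
  exact AdjoinRoot.aeval_eq p

theorem finrank_ker_aeval_mulX (φ : MonicIrred F) (k : ℕ) :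
    Module.finrank F (LinearMap.ker (aeval Λ.mulX (φ.1 ^ k))) =
      ((Λ φ).parts.map fun r => min r k).sum * φ.1.natDegree := by
  classical
  rw [(kerPiEquiv _ (fun x => Algebra.lmul F _ (AdjoinRoot.mk (Λ.divisor x) (φ.1 ^ k)))
    fun v x => by rw [aeval_mulX]; rfl).finrank_eq, Module.finrank_pi_fintype]
  -- Distinct monic irreducibles are coprime, so only the summands belonging to `φ` contribute.
  have key (x : Λ.Summand) : Module.finrank F (LinearMap.ker
      (Algebra.lmul F (AdjoinRoot (Λ.divisor x)) (AdjoinRoot.mk (Λ.divisor x) (φ.1 ^ k)))) =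
      if x.1 = φ then min (x.2.1 : ℕ) k * φ.1.natDegree else 0 := by
    split_ifs with h
    · obtain ⟨ψ, r⟩ := x
      subst h
      exact finrank_ker_lmul_pow ψ.2.2.ne_zero _ _
    · refine finrank_ker_lmul_of_isCoprime (IsCoprime.pow ?_)
      refine (x.1.2.2.coprime_iff_not_dvd).2 fun hd => h (Subtype.ext ?_)
      exact eq_of_monic_of_associated x.1.2.1 φ.2.1 (x.1.2.2.associated_of_dvd φ.2.2 hd)
  rw [Finset.sum_congr rfl fun x _ => key x]
  have hinj : Function.Injective (fun r => (⟨φ, r⟩ : Λ.Summand)) :=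
    fun _ _ h => eq_of_heq (Sigma.mk.inj h).2
  rw [← Finset.sum_subset (Finset.subset_univ (Finset.univ.image fun r => (⟨φ, r⟩ : Λ.Summand)))
    (fun x _ hx => if_neg fun h => hx (by
      obtain ⟨ψ, r⟩ := x
      subst h
      exact Finset.mem_image_of_mem _ (Finset.mem_univ r))),
    Finset.sum_image hinj.injOn]
  simp only [if_true]
  rw [← Finset.sum_mul]
  congr 1
  conv_rhs => rw [← Multiset.map_univ_coe (Λ φ).parts, Multiset.map_map]
  rfl

end ClassData

/-! ### Similarity of matrices as isomorphism of cyclic sums -/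

/-- `f` is, up to isomorphism, multiplication by `X` on the direct sum of the `F[X] / (d j)`. -/
def IsCyclicSum {F V J : Type*} [Field F] [AddCommGroup V] [Module F V] (f : Module.End F V)
    (d : J → F[X]) : Prop :=
  ∃ E : V ≃ₗ[F] ∀ j, AdjoinRoot (d j), ∀ v j, E (f v) j = AdjoinRoot.root (d j) * E v j

/-- The basis `1, X, …, X ^ (deg f - 1)` of `F[X] / (f)`. -/
def powBasis {F : Type*} [Field F] {f : F[X]} (hf : f ≠ 0) :
    Module.Basis (Fin f.natDegree) F (AdjoinRoot f) :=
  (AdjoinRoot.powerBasis hf).basis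

theorem powBasis_repr_root_mul {F : Type*} [Field F] {f : F[X]} (hf : f.Monic)
    (i j : Fin f.natDegree) :
    (powBasis hf.ne_zero).repr (AdjoinRoot.root f * powBasis hf.ne_zero j) i =
      companion f j i := by
  let pb := AdjoinRoot.powerBasis hf.ne_zero
  have h := (Algebra.leftMulMatrix_eq_repr_mul pb.basis pb.gen i j).symm.trans
    (congrFun (congrFun pb.leftMulMatrix i) j)
  rw [PowerBasis.minpolyGen_eq, AdjoinRoot.minpoly_powerBasis_gen_of_monic hf] at h
  exact h

/-- Transposes enter because `companion` has its ones on the superdiagonal: its rows, not its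
columns, hold the coordinates of `X * X^j`. The map `P` corresponds to the transpose of `U⁻¹`. -/
theorem exists_isUnit_conj_iff {F : Type*} [Field F] {n : ℕ} (A S : Matrix (Fin n) (Fin n) F) :
    (∃ U : Matrix (Fin n) (Fin n) F, IsUnit U ∧ A = U⁻¹ * S * U) ↔
      ∃ P : (Fin n → F) ≃ₗ[F] (Fin n → F),
        ∀ v, P (A.transpose.toLin' v) = S.transpose.toLin' (P v) := by
  constructor
  · rintro ⟨U, hU, rfl⟩
    have hd := (Matrix.isUnit_iff_isUnit_det U).1 hU
    have h1 : U⁻¹.transpose * U.transpose = 1 := by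
      rw [← Matrix.transpose_mul, Matrix.mul_nonsing_inv _ hd, Matrix.transpose_one]
    have h2 : U.transpose * U⁻¹.transpose = 1 := by
      rw [← Matrix.transpose_mul, Matrix.nonsing_inv_mul _ hd, Matrix.transpose_one]
    refine ⟨Matrix.toLin'OfInv h2 h1, fun v => ?_⟩
    change U⁻¹.transpose.toLin' _ = S.transpose.toLin' (U⁻¹.transpose.toLin' v)
    simp only [Matrix.toLin'_apply, Matrix.mulVec_mulVec, Matrix.transpose_mul]
    rw [← mul_assoc, ← mul_assoc, h1, one_mul]
  · rintro ⟨P, hP⟩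
    have h1 : LinearMap.toMatrix' P.toLinearMap * LinearMap.toMatrix' P.symm.toLinearMap = 1 := by
      rw [← LinearMap.toMatrix'_comp, LinearEquiv.comp_coe, LinearEquiv.symm_trans_self,
        LinearEquiv.refl_toLinearMap, LinearMap.toMatrix'_id]
    have h2 := mul_eq_one_comm.1 h1
    have hPA : LinearMap.toMatrix' P.toLinearMap * A.transpose =
        S.transpose * LinearMap.toMatrix' P.toLinearMap := by
      apply Matrix.toLin'.injective
      simp only [Matrix.toLin'_mul, Matrix.toLin'_toMatrix']
      exact LinearMap.ext hP
    have h1' := congrArg Matrix.transpose h1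
    have h2' := congrArg Matrix.transpose h2
    rw [Matrix.transpose_mul, Matrix.transpose_one] at h1' h2'
    have hinv := Matrix.inv_eq_right_inv h1'
    refine ⟨(LinearMap.toMatrix' P.symm.toLinearMap).transpose,
      IsUnit.of_mul_eq_one _ h1', ?_⟩
    have hAP := congrArg Matrix.transpose hPA
    rw [Matrix.transpose_mul, Matrix.transpose_mul, Matrix.transpose_transpose,
      Matrix.transpose_transpose] at hAP
    rw [hinv, ← hAP, mul_assoc, h2', mul_one]

namespace ClassData

variable {F : Type*} [Field F] (Λ : ClassData F)

/-- The basis of powers of `X` in each cyclic summand. -/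
def spaceBasis : Module.Basis Λ.Index F Λ.Space :=
  (Pi.basis fun x => powBasis (Λ.divisor_monic x).ne_zero).reindex (Equiv.sigmaAssoc
    fun (φ : MonicIrred F) (r : (Λ φ).parts.ToType) => Fin (φ.1 ^ r.1).natDegree)

theorem mulX_apply (v : Λ.Space) (x : Λ.Summand) :
    Λ.mulX v x = AdjoinRoot.root (Λ.divisor x) * v x := rfl

theorem spaceBasis_repr_mulX (i j : Λ.Index) :
    Λ.spaceBasis.repr (Λ.mulX (Λ.spaceBasis j)) i = Λ.standardRep j i := by
  classical
  obtain ⟨φ, r, i⟩ := i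
  obtain ⟨ψ, s, j⟩ := j
  have hj : Λ.spaceBasis ⟨ψ, s, j⟩ =
      Pi.single (⟨ψ, s⟩ : Λ.Summand) (powBasis (Λ.divisor_monic ⟨ψ, s⟩).ne_zero j) := by
    rw [spaceBasis, Module.Basis.reindex_apply]
    exact Pi.basis_apply _ _
  have hi (v : Λ.Space) : Λ.spaceBasis.repr v ⟨φ, r, i⟩ =
      (powBasis (Λ.divisor_monic ⟨φ, r⟩).ne_zero).repr (v ⟨φ, r⟩) i := by
    rw [spaceBasis, Module.Basis.repr_reindex_apply]
    rfl
  rw [hi, mulX_apply, hj, standardRep]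
  by_cases h : ψ = φ
  · subst h
    rw [Matrix.blockDiagonal'_apply_eq]
    by_cases h' : s = r
    · subst h'
      rw [Matrix.blockDiagonal'_apply_eq, Pi.single_eq_same]
      exact powBasis_repr_root_mul (Λ.divisor_monic ⟨ψ, s⟩) i j
    · rw [Matrix.blockDiagonal'_apply_ne _ _ _ h', Pi.single_eq_of_ne, mul_zero, map_zero,
        Finsupp.zero_apply]
      intro hs
      exact h' (eq_of_heq (Sigma.mk.inj hs).2).symm
  · rw [Matrix.blockDiagonal'_apply_ne _ _ _ h, Pi.single_eq_of_ne, mul_zero, map_zero,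
      Finsupp.zero_apply]
    intro hs
    exact h (Sigma.mk.inj hs).1.symm

theorem equivFun_mulX {n : ℕ} (e : Fin n ≃ Λ.Index) (w : Λ.Space) :
    (Λ.spaceBasis.reindex e.symm).equivFun (Λ.mulX w) =
      (Λ.standardRep.submatrix e e).transpose.toLin'
        ((Λ.spaceBasis.reindex e.symm).equivFun w) := by
  have h := LinearMap.toMatrix_mulVec_repr (Λ.spaceBasis.reindex e.symm)
    (Λ.spaceBasis.reindex e.symm) Λ.mulX w
  have hS : LinearMap.toMatrix (Λ.spaceBasis.reindex e.symm) (Λ.spaceBasis.reindex e.symm)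
      Λ.mulX = (Λ.standardRep.submatrix e e).transpose := by
    ext i j
    rw [LinearMap.toMatrix_apply, Module.Basis.repr_reindex_apply, Module.Basis.reindex_apply]
    exact Λ.spaceBasis_repr_mulX _ _
  rw [hS] at h
  exact h.symm

end ClassData

theorem hasClassData_iff {F : Type*} [Field F] {n : ℕ} (A : Matrix (Fin n) (Fin n) F)
    (Λ : ClassData F) :
    HasClassData A Λ ↔ IsCyclicSum A.transpose.toLin' Λ.divisor := by
  constructor
  · rintro ⟨e, h⟩
    obtain ⟨P, hP⟩ := (exists_isUnit_conj_iff _ _).1 h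
    refine ⟨P.trans (Λ.spaceBasis.reindex e.symm).equivFun.symm, fun v j => ?_⟩
    rw [← Λ.mulX_apply]
    refine congrFun ?_ j
    apply (Λ.spaceBasis.reindex e.symm).equivFun.injective
    rw [Λ.equivFun_mulX]
    simp only [LinearEquiv.trans_apply, LinearEquiv.apply_symm_apply]
    exact hP v
  · rintro ⟨E, hE⟩
    -- The numbering exists because two bases of the same space have equinumerous index sets.
    obtain ⟨e⟩ : Nonempty (Fin n ≃ Λ.Index) :=
      ⟨((Pi.basisFun F (Fin n)).map E).indexEquiv Λ.spaceBasis⟩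
    refine ⟨e, (exists_isUnit_conj_iff _ _).2
      ⟨E.trans (Λ.spaceBasis.reindex e.symm).equivFun, fun v => ?_⟩⟩
    rw [LinearEquiv.trans_apply, LinearEquiv.trans_apply, ← Λ.equivFun_mulX]
    congr 1
    ext1 j
    exact hE v j

theorem IsCyclicSum.finrank_ker_aeval {F V : Type*} [Field F] [AddCommGroup V] [Module F V]
    {f : Module.End F V} {Λ : ClassData F} (h : IsCyclicSum f Λ.divisor) (φ : MonicIrred F)
    (k : ℕ) :
    Module.finrank F (LinearMap.ker (aeval f (φ.1 ^ k))) =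
      ((Λ φ).parts.map fun r => min r k).sum * φ.1.natDegree := by
  obtain ⟨E, hE⟩ := h
  have hconj : Λ.mulX = LinearEquiv.conjAlgEquiv F E f := by
    ext1 w
    rw [LinearEquiv.conjAlgEquiv_apply_apply]
    ext1 j
    rw [hE, LinearEquiv.apply_symm_apply, Λ.mulX_apply]
  rw [← Λ.finrank_ker_aeval_mulX, hconj]
  have h (p : F[X]) : aeval (LinearEquiv.conjAlgEquiv F E f) p = LinearEquiv.conjAlgEquiv F E (aeval f p) :=
    aeval_algHom_apply (LinearEquiv.conjAlgEquiv F E) f p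
  have hker : (LinearMap.ker (aeval f (φ.1 ^ k))).map E.toLinearMap =
      LinearMap.ker (LinearEquiv.conjAlgEquiv F E (aeval f (φ.1 ^ k))) := by
    ext w
    rw [Submodule.mem_map_equiv, LinearMap.mem_ker, LinearMap.mem_ker,
      LinearEquiv.conjAlgEquiv_apply_apply, LinearEquiv.map_eq_zero_iff]
  rw [h, ← hker]
  exact (E.submoduleMap _).finrank_eq

/-! ### Existence of elementary divisors -/

theorem subsingleton_adjoinRoot {F : Type*} [Field F] {f : F[X]} (hf : IsUnit f) :
    Subsingleton (AdjoinRoot f) := by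
  refine ⟨fun a b => ?_⟩
  obtain ⟨p, rfl⟩ := AdjoinRoot.mk_surjective a
  obtain ⟨q, rfl⟩ := AdjoinRoot.mk_surjective b
  exact AdjoinRoot.mk_eq_mk.2 hf.dvd

/-- Cyclic summands may be relabelled, trivial ones omitted, and generators of the relations
replaced by associated ones. -/
theorem IsCyclicSum.relabel {F V J J' : Type*} [Field F] [AddCommGroup V] [Module F V]
    [Finite J'] {f : Module.End F V} {d : J → F[X]} {d' : J' → F[X]} (h : IsCyclicSum f d)
    (σ : J' → J) (hσ : Function.Injective σ) (hrange : ∀ j, j ∉ Set.range σ → IsUnit (d j))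
    (hd : ∀ j, Associated (d (σ j)) (d' j)) : IsCyclicSum f d' := by
  classical
  have := Fintype.ofFinite J'
  obtain ⟨E, hE⟩ := h
  let τ (j : J') : AdjoinRoot (d (σ j)) ≃ₐ[F] AdjoinRoot (d' j) :=
    AdjoinRoot.algEquivOfAssociated F _ _ (hd j)
  let T : (∀ j, AdjoinRoot (d j)) →ₗ[F] ∀ j, AdjoinRoot (d' j) :=
    LinearMap.pi fun j => (τ j).toLinearMap ∘ₗ LinearMap.proj (σ j)
  have hT (w) (j : J') : T w j = τ j (w (σ j)) := rfl
  have hbij : Function.Bijective T := by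
    constructor
    · refine (injective_iff_map_eq_zero T).2 fun w hw => ?_
      ext1 j
      by_cases hj : j ∈ Set.range σ
      · obtain ⟨j', rfl⟩ := hj
        have := congrFun hw j'
        rwa [hT, Pi.zero_apply, map_eq_zero_iff _ (τ j').injective] at this
      · have := subsingleton_adjoinRoot (hrange j hj)
        exact Subsingleton.elim _ _
    · intro y
      refine ⟨∑ j, Pi.single (σ j) ((τ j).symm (y j)), ?_⟩
      ext1 j
      rw [hT, Finset.sum_apply, Finset.sum_eq_single j, Pi.single_eq_same,
        AlgEquiv.apply_symm_apply]
      · intro i _ hi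
        exact Pi.single_eq_of_ne (fun h => hi (hσ h).symm) _
      · intro hj
        exact absurd (Finset.mem_univ j) hj
  refine ⟨E.trans (LinearEquiv.ofBijective T hbij), fun v j => ?_⟩
  change τ j (E (f v) (σ j)) = _ * τ j (E v (σ j))
  rw [hE, map_mul]
  congr 1
  exact AdjoinRoot.algEquivOfAssociated_root ..

theorem exists_isCyclicSum_prime_powers.{u, v} {F : Type u} {V : Type v} [Field F] [AddCommGroup V]
    [Module F V] [Module.Finite F V] (f : Module.End F V) :
    ∃ (ι : Type u) (_ : Fintype ι) (p : ι → F[X]) (_ : ∀ i, Irreducible (p i)) (e : ι → ℕ),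
      IsCyclicSum f fun i => p i ^ e i := by
  -- The minimal polynomial annihilates the module, so the structure theorem for torsion modules
  -- over a PID applies.
  have htors : Module.IsTorsion F[X] (Module.AEval' f) := by
    intro x
    refine ⟨⟨minpoly F f, mem_nonZeroDivisors_of_ne_zero
      (minpoly.ne_zero (Algebra.IsIntegral.isIntegral f))⟩, ?_⟩
    apply (Module.AEval'.of f).symm.injective
    change (Module.AEval.of F V f).symm (minpoly F f • x) = _
    rw [Module.AEval.of_symm_smul, minpoly.aeval, zero_smul, map_zero]
  obtain ⟨ι, hι, p, hp, e, ⟨g⟩⟩ := Module.equiv_directSum_of_isTorsion htors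
  let g' := g.trans (DirectSum.linearEquivFunOnFintype F[X] ι _)
  refine ⟨ι, hι, p, hp, e, ?_⟩
  let E : V ≃ₗ[F] ∀ i, F[X] ⧸ Submodule.span F[X] {p i ^ e i} :=
    (Module.AEval'.of f).trans (g'.restrictScalars F)
  refine ⟨E, fun v j => ?_⟩
  have h1 : E (f v) = (X : F[X]) • E v := by
    change g' (Module.AEval'.of f (f v)) = X • g' (Module.AEval'.of f v)
    rw [← map_smul]
    congr 1
    exact (Module.AEval.X_smul_of f v).symm
  refine (congrFun h1 j).trans ?_
  have hmul (w : F[X] ⧸ Submodule.span F[X] {p j ^ e j}) :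
      (X : F[X]) • w = AdjoinRoot.mk (p j ^ e j) X * (show AdjoinRoot (p j ^ e j) from w) := by
    obtain ⟨q, rfl⟩ := Submodule.Quotient.mk_surjective _ w
    rfl
  exact hmul _

/-- Every endomorphism has elementary divisors. -/
theorem exists_classData {F V : Type*} [Field F] [AddCommGroup V]
    [Module F V] [Module.Finite F V] (f : Module.End F V) :
    ∃ Λ : ClassData F, IsCyclicSum f Λ.divisor := by
  classical
  obtain ⟨ι, _, p, hp, e, h⟩ := exists_isCyclicSum_prime_powers f
  let q (i : ι) : MonicIrred F :=
    ⟨normalize (p i), monic_normalize (hp i).ne_zero,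
      (normalize_associated _).symm.irreducible (hp i)⟩
  -- Exponent 0 gives a zero module and would be an illegal part 0, so it is discarded.
  let s (φ : MonicIrred F) : Finset ι := {i | e i ≠ 0 ∧ q i = φ}
  let m (φ : MonicIrred F) : Multiset ℕ := (s φ).val.map e
  have hm (φ) {r} (hr : r ∈ m φ) : 0 < r := by
    obtain ⟨i, hi, rfl⟩ := Multiset.mem_map.1 hr
    exact Nat.pos_of_ne_zero (Finset.mem_filter.1 hi).2.1
  let Λ : ClassData F :=
    { toFun φ := ⟨(m φ).sum, m φ, hm φ, rfl⟩
      finite_support := by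
        refine (Set.finite_range q).subset fun φ hφ => ?_
        obtain ⟨r, hr⟩ := Multiset.exists_mem_of_ne_zero hφ
        obtain ⟨i, hi, -⟩ := Multiset.mem_map.1 hr
        exact ⟨i, (Finset.mem_filter.1 hi).2.2⟩ }
  have hparts (φ) : (Λ φ).parts = m φ := rfl
  let t (φ : MonicIrred F) (r : ℕ) : Finset ι := (s φ).filter fun i => r = e i
  have hcard (φ r) : (t φ r).card = (Λ φ).parts.count r := by
    rw [hparts, Multiset.count_map]
    rfl
  -- The repetition label of a part `r` is an element of `Fin` of its multiplicity, here matched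
  -- with the set `t φ r` of factors having exponent `r`.
  let σ (x : Λ.Summand) : ι := ((Finset.equivFinOfCardEq (hcard x.1 x.2.1)).symm x.2.2).1
  have hmem (x) : σ x ∈ t x.1 x.2.1 :=
    ((Finset.equivFinOfCardEq (hcard x.1 x.2.1)).symm x.2.2).2
  have hσ (x) : q (σ x) = x.1 ∧ e (σ x) = x.2.1 := by
    have := Finset.mem_filter.1 (hmem x)
    exact ⟨(Finset.mem_filter.1 this.1).2.2, this.2.symm⟩
  refine ⟨Λ, h.relabel σ ?_ ?_ ?_⟩
  · intro x y hxy
    have hφ : x.1 = y.1 := by rw [← (hσ x).1, ← (hσ y).1, hxy]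
    have hr : x.2.1 = y.2.1 := by rw [← (hσ x).2, ← (hσ y).2, hxy]
    obtain ⟨φ, r, k⟩ := x
    obtain ⟨ψ, s, l⟩ := y
    dsimp only at hφ
    subst hφ
    dsimp only at hr
    subst hr
    obtain rfl : k = l := (Finset.equivFinOfCardEq (hcard φ r)).symm.injective (Subtype.ext hxy)
    rfl
  · intro i hi
    by_cases he : e i = 0
    · simp only [he, pow_zero, isUnit_one]
    · have hit : i ∈ t (q i) (e i) :=
        Finset.mem_filter.2 ⟨Finset.mem_filter.2 ⟨Finset.mem_univ i, he, rfl⟩, rfl⟩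
      refine absurd ⟨⟨q i, e i, Finset.equivFinOfCardEq (hcard (q i) (e i)) ⟨i, hit⟩⟩, ?_⟩ hi
      change ((Finset.equivFinOfCardEq (hcard (q i) (e i))).symm
        (Finset.equivFinOfCardEq (hcard (q i) (e i)) ⟨i, hit⟩)).1 = i
      rw [Equiv.symm_apply_apply]
  · intro x
    rw [(hσ x).2]
    refine Associated.pow_pow ?_
    rw [← (hσ x).1]
    exact (normalize_associated _).symm

/-! ### Multiplicities from second differences, and uniqueness -/

/-- For a single part `a`, the function `k ↦ min a k` bends only at `k = a`, where its slope drops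
by 1. -/
theorem sum_min_second_difference (s : Multiset ℕ) {i : ℕ} (hi : 1 ≤ i) :
    2 * (s.map fun r => min r i).sum =
      (s.map fun r => min r (i - 1)).sum + (s.map fun r => min r (i + 1)).sum + s.count i := by
  induction s using Multiset.induction_on with
  | empty => simp
  | cons a s ih =>
    simp only [Multiset.map_cons, Multiset.sum_cons, Multiset.count_cons]
    split_ifs <;> omega

/-- With step 2 the bend at `a` is still seen from `2 * i` when `|a - 2 * i| ≤ 1`: in full (weight
2) for `a = 2 * i`, by half (weight 1) for its two neighbours. -/
theorem sum_min_second_difference_two_mul (s : Multiset ℕ) {i : ℕ} (hi : 1 ≤ i) :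
    2 * (s.map fun r => min r (2 * i)).sum =
      (s.map fun r => min r (2 * (i - 1))).sum + (s.map fun r => min r (2 * (i + 1))).sum +
        (2 * s.count (2 * i) + s.count (2 * i - 1) + s.count (2 * i + 1)) := by
  induction s using Multiset.induction_on with
  | empty => simp
  | cons a s ih =>
    simp only [Multiset.map_cons, Multiset.sum_cons, Multiset.count_cons]
    split_ifs <;> omega

theorem IntPartition.ext_mult {l m : IntPartition} (h : ∀ i, 1 ≤ i → l.mult i = m.mult i) :
    l = m := by
  obtain ⟨v, l⟩ := l
  obtain ⟨w, m⟩ := m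
  have hp : l.parts = m.parts := by
    ext i
    rcases Nat.eq_zero_or_pos i with rfl | hi
    · rw [Multiset.count_eq_zero_of_notMem fun h => (l.parts_pos h).ne' rfl,
        Multiset.count_eq_zero_of_notMem fun h => (m.parts_pos h).ne' rfl]
    · exact h i hi
  obtain rfl : v = w := by rw [← l.parts_sum, ← m.parts_sum, hp]
  rw [Nat.Partition.ext hp]

theorem natDegree_pos {F : Type*} [Field F] (φ : MonicIrred F) : 0 < φ.1.natDegree :=
  φ.2.2.natDegree_pos

/-- The elementary divisors of an endomorphism are unique. -/
theorem IsCyclicSum.classData_unique {F V : Type*} [Field F] [AddCommGroup V] [Module F V]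
    {f : Module.End F V} {M N : ClassData F} (hM : IsCyclicSum f M.divisor)
    (hN : IsCyclicSum f N.divisor) : N = M := by
  have hfun : N.toFun = M.toFun := by
    ext1 φ
    have key (k : ℕ) : ((N φ).parts.map fun r => min r k).sum =
        ((M φ).parts.map fun r => min r k).sum :=
      Nat.eq_of_mul_eq_mul_right (natDegree_pos φ)
        ((hN.finrank_ker_aeval φ k).symm.trans (hM.finrank_ker_aeval φ k))
    refine IntPartition.ext_mult fun i hi => ?_
    have h1 := sum_min_second_difference (N φ).parts hi
    have h2 := sum_min_second_difference (M φ).parts hi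
    rw [key, key, key] at h1
    rw [IntPartition.mult, IntPartition.mult]
    omega
  cases M
  cases N
  cases hfun
  rfl

/-! ### Squaring in characteristic 2 -/

section Frobenius

variable {F : Type*} [Field F] [CharP F 2] [PerfectRing F 2]

/-- Squaring the coefficients, which squares the roots. -/
def frobeniusIrred : MonicIrred F ≃ MonicIrred F :=
  (mapEquiv (frobeniusEquiv F 2)).toEquiv.subtypeEquiv fun φ => by
    change _ ↔ (φ.map _).Monic ∧ Irreducible (mapEquiv (frobeniusEquiv F 2) φ)
    rw [MulEquiv.irreducible_iff, Function.Injective.monic_map_iff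
      (f := (frobeniusEquiv F 2 : F →+* F)) (frobeniusEquiv F 2).injective]

theorem coe_frobeniusIrred (φ : MonicIrred F) :
    (frobeniusIrred φ).1 = φ.1.map (frobenius F 2) := rfl

/-- Frobenius commutes with the embedding into the algebraic closure; there it sends the
factorization `∏ (X - α)` to `∏ (X - α^2)`. -/
theorem frobeniusIrred_map (φ : MonicIrred F) :
    (frobeniusIrred φ).1.map (algebraMap F (AlgebraicClosure F)) = rootPow 2 φ.1 := by
  have : CharP (AlgebraicClosure F) 2 := charP_of_injective_algebraMap
    (algebraMap F (AlgebraicClosure F)).injective 2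
  have hcomm : (algebraMap F (AlgebraicClosure F)).comp (frobenius F 2) =
      (frobenius (AlgebraicClosure F) 2).comp (algebraMap F (AlgebraicClosure F)) :=
    RingHom.ext fun x => (algebraMap F (AlgebraicClosure F)).map_frobenius (p := 2) x
  have hprod := (IsAlgClosed.splits
    (φ.1.map (algebraMap F (AlgebraicClosure F)))).eq_prod_roots_of_monic (φ.2.1.map _)
  rw [coe_frobeniusIrred, map_map, hcomm, ← map_map, hprod, rootPow, aroots,
    Polynomial.map_multiset_prod, Multiset.map_map]
  congr 1
  refine Multiset.map_congr rfl fun α _ => ?_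
  simp [frobenius_def]

/-- Evaluates the identity `φ^{(2)}(X^2) = φ(X)^2`, which is Frobenius on `F[X]`, at `a`. -/
theorem aeval_sq_frobeniusIrred {A : Type*} [Ring A] [Algebra F A] (a : A) (φ : MonicIrred F)
    (k : ℕ) : aeval (a ^ 2) ((frobeniusIrred φ).1 ^ k) = aeval a (φ.1 ^ (2 * k)) := by
  rw [pow_mul, ← map_frobenius_expand (p := 2), coe_frobeniusIrred, map_expand, ← map_pow, expand_aeval]

theorem mult_frobeniusIrred {V : Type*} [AddCommGroup V] [Module F V] {f : Module.End F V}
    {Λ M : ClassData F} (hΛ : IsCyclicSum f Λ.divisor) (hM : IsCyclicSum (f ^ 2) M.divisor)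
    (φ : MonicIrred F) {i : ℕ} (hi : 1 ≤ i) :
    (M (frobeniusIrred φ)).mult i =
      2 * (Λ φ).mult (2 * i) + (Λ φ).mult (2 * i - 1) + (Λ φ).mult (2 * i + 1) := by
  -- Both sides, times the common degree of `φ` and `φ^{(2)}`, are the dimension of the same kernel.
  have key (k : ℕ) : ((M (frobeniusIrred φ)).parts.map fun r => min r k).sum =
      ((Λ φ).parts.map fun r => min r (2 * k)).sum := by
    have h := hM.finrank_ker_aeval (frobeniusIrred φ) k
    rw [aeval_sq_frobeniusIrred, hΛ.finrank_ker_aeval, coe_frobeniusIrred, natDegree_map] at h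
    exact (Nat.eq_of_mul_eq_mul_right (natDegree_pos φ) h).symm
  have h1 := sum_min_second_difference (M (frobeniusIrred φ)).parts hi
  have h2 := sum_min_second_difference_two_mul (Λ φ).parts hi
  rw [key, key, key] at h1
  simp only [IntPartition.mult]
  omega

end Frobenius

end MatSq

end

theorem mainTheorem4 {F : Type*} [Field F] [Finite F] (k : ℕ) (hF : Nat.card F = 2 ^ k)
    (n : ℕ) (A : Matrix (Fin n) (Fin n) F) (Λ : MatSq.ClassData F)
    (hA : MatSq.HasClassData A Λ) :
    -- `sq φ` is `φ^{(2)}`; in particular `φ ↦ φ^{(2)}` is a bijection of the index set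
    ∃ sq : MatSq.MonicIrred F ≃ MatSq.MonicIrred F,
      (∀ φ, (sq φ).1.map (algebraMap F (AlgebraicClosure F)) = MatSq.rootPow 2 φ.1) ∧
      ∃ M : MatSq.ClassData F,
        MatSq.HasClassData (A ^ 2) M ∧
        (∀ N : MatSq.ClassData F, MatSq.HasClassData (A ^ 2) N → N = M) ∧
        ∀ (φ : MatSq.MonicIrred F) (i : ℕ), 1 ≤ i →
          (M (sq φ)).mult i =
            2 * (Λ φ).mult (2 * i) + (Λ φ).mult (2 * i - 1) + (Λ φ).mult (2 * i + 1) := by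
  have := Fintype.ofFinite F
  have : CharP F 2 := charP_of_card_eq_prime_pow (f := k) (by rw [← Nat.card_eq_fintype_card, hF])
  have hsq : (A ^ 2).transpose.toLin' = A.transpose.toLin' ^ 2 := by
    rw [Matrix.transpose_pow, Matrix.toLin'_pow]
  obtain ⟨M, hM⟩ := MatSq.exists_classData (A ^ 2).transpose.toLin'
  refine ⟨MatSq.frobeniusIrred, MatSq.frobeniusIrred_map, M,
    (MatSq.hasClassData_iff _ _).2 hM,
    fun N hN => hM.classData_unique ((MatSq.hasClassData_iff _ _).1 hN), fun φ i hi => ?_⟩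
  rw [hsq] at hM
  exact MatSq.mult_frobeniusIrred ((MatSq.hasClassData_iff _ _).1 hA) hM φ hi
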